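/- For a compact set $K\subset\mathbb C$ consider the following three quantities. * The logarithmic capacity $\mathrm{cap}(K)=e^{-V_K}\in[0,\infty)$, where $V_K=\inf_\mu \iint \log\frac{1}{|z-t|}\,d\mu(z)\,d\mu(t)\in(-\infty,+\infty]$, the infimum being over all Borel probability measures $\mu$ carried by $K$ (with $\log\frac10=+\infty$ and $e^{-\infty}=0$). * The transfinite diameter $\tau(K)=\lim_{n\to\infty}\delta_n(K)$, where $\delta_n(K)=\max_{z_1,\dots,z_n\in K}\prod_{i<j}|z_i-z_j|^{2/(n(n-1))}$ for $n\ge 2$. * The Chebyshev constant $\mathrm{cheb}(K)=\lim_{n\to\infty}t_n(K)^{1/n}$, where $t_n(K)=\inf_{P}\,\sup_{z\in K}|z^n+P(z)|$, the infimum being over all $P\in\mathbb C[X]$ of degree less than $n$. Let $l\ge 0$ and let $[a,b]\subset\mathbb R\subset\mathbb C$ be a real segment of length $b-a=2l$. Then the capacity of $[a,b]$, in each of these three senses, equals $l/2$: the limits defining $\tau([a,b])$ and $\mathrm{cheb}([a,b])$ exist, and $$\mathrm{cap}([a,b])=\tau([a,b])=\mathrm{cheb}([a,b])=\frac l2 .$$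 In particular, $\mathrm{cap}([a,b])$ is smaller than, equal to, or larger than $1$ if and only if the length $b-a$ is, respectively, smaller than, equal to, or larger than $4$. -/

import Mathlib

open MeasureTheory Filter Topology
open scoped ENNReal Polynomial

noncomputable section

namespace PlanarCapacity

/-- The logarithmic kernel `log (1 / |z - t|)`, with value `+∞` on the diagonal
(`ENNReal.log 0 = ⊥`). -/
def logKernel (z t : ℂ) : EReal := -ENNReal.log ‖z - t‖ₑ

/-- The logarithmic energy `I(μ) = ∬ log (1 / |z - t|) dμ(t) dμ(z)`, as the integral of the
positive part minus the integral of the negative part. For a finite measure carried by a bounded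
set the second integral is finite, so that the difference is meaningful, possibly `+∞`. -/
def energy (μ : Measure ℂ) : EReal :=
  ((∫⁻ z, ∫⁻ t, (logKernel z t).toENNReal ∂μ ∂μ : ℝ≥0∞) : EReal) -
    ((∫⁻ z, ∫⁻ t, (-logKernel z t).toENNReal ∂μ ∂μ : ℝ≥0∞) : EReal)

/-- The Robin constant `V_K`: the infimum of the energy over all Borel probability measures
carried by `K`. -/
def robinConstant (K : Set ℂ) : EReal :=
  sInf {v : EReal | ∃ μ : Measure ℂ, IsProbabilityMeasure μ ∧ μ Kᶜ = 0 ∧ v = energy μ}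

/-- The logarithmic capacity `exp (-V_K)` of a compact set `K` (with `exp (-∞) = 0`). -/
def logCapacity (K : Set ℂ) : ℝ≥0∞ := EReal.exp (-robinConstant K)

/-- The `n`-th diameter `δ_n(K)`, the maximum over `z_1, …, z_n ∈ K` of
`∏_{i < j} |z_i - z_j| ^ (2 / (n (n - 1)))` (meant for `n ≥ 2` and `K` compact). -/
def nthDiameter (K : Set ℂ) (n : ℕ) : ℝ :=
  ⨆ z : Fin n → K, ∏ i : Fin n, ∏ j ∈ Finset.Ioi i,
    ‖(z i : ℂ) - (z j : ℂ)‖ ^ (2 / ((n : ℝ) * ((n : ℝ) - 1)))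

/-- `τ` is the transfinite diameter of `K`: the limit of the `n`-th diameters. -/
def IsTransfiniteDiameter (K : Set ℂ) (τ : ℝ) : Prop :=
  Tendsto (nthDiameter K) atTop (𝓝 τ)

/-- `t_n(K)`: the infimum over complex polynomials `P` of degree less than `n` of the uniform
norm of `X ^ n + P` on `K` (meant for `K` compact). -/
def chebyshevNumber (K : Set ℂ) (n : ℕ) : ℝ :=
  ⨅ P : Polynomial.degreeLT ℂ n, ⨆ z : K, ‖(Polynomial.X ^ n + (P : ℂ[X])).eval (z : ℂ)‖

/-- `c` is the Chebyshev constant of `K`: the limit of `t_n(K) ^ (1 / n)`. -/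
def IsChebyshevConstant (K : Set ℂ) (c : ℝ) : Prop :=
  Tendsto (fun n : ℕ => chebyshevNumber K n ^ (1 / (n : ℝ))) atTop (𝓝 c)

/-- The real segment `[a, b]` as a subset of the complex plane. -/
def realSegment (a b : ℝ) : Set ℂ := Complex.ofReal '' Set.Icc a b

end PlanarCapacity

end

namespace PlanarCapacity

/-! ### Real segments -/

/-! Everything rests on the parametrization `c + l cos θ = c + (l/2)(w + 1/w)`, `w = exp (iθ)`.

Polynomials: for `p` monic of degree `n`, `w ^ n * p (c + (l/2)(w + 1/w))` is a polynomial in `w`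
with value `(l/2)^n` at `0`, so the maximum principle bounds the norm of `p` on the segment below by
`(l/2)^n` (`pow_le_of_forall_norm_eval_le`). Rescaled Chebyshev polynomials reach `2 (l/2)^n`
(`exists_monic_norm_eval_le`). The `n`-th root kills the factor `2`, which gives the Chebyshev
constant. The same two bounds control products of distances, from below by a greedy choice of points
and from above by a Vandermonde determinant, up to a factor `(2n)^n` which is also lost in the
limit.

Energy: formally the kernel is `-log (l/2) + ∑ (2/n) cos nθ cos nφ`, a constant plus a positive
definite kernel, so every energy is at least `-log (l/2)` (`neg_log_le_energy`). Equality holds for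
the image of the uniform angle, whose potential is constant on the segment because `log |w - a|` has
mean zero on the unit circle when `|a| = 1` (`energy_arcsineMeasure`). -/

theorem mem_realSegment_iff {c l : ℝ} (hl : 0 ≤ l) {z : ℂ} :
    z ∈ realSegment (c - l) (c + l) ↔ ∃ θ : ℝ, z = ((c + l * Real.cos θ : ℝ) : ℂ) := by
  constructor
  · rintro ⟨x, ⟨h1, h2⟩, rfl⟩
    rcases hl.eq_or_lt with rfl | hl
    · exact ⟨0, by congr 1; linarith⟩
    · refine ⟨Real.arccos ((x - c) / l), ?_⟩
      rw [Real.cos_arccos]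
      · congr 1; field_simp; ring
      · rw [le_div_iff₀ hl]; linarith
      · rw [div_le_iff₀ hl]; linarith
  · rintro ⟨θ, rfl⟩
    refine ⟨_, ⟨?_, ?_⟩, rfl⟩
    · nlinarith [Real.neg_one_le_cos θ]
    · nlinarith [Real.cos_le_one θ]

theorem isCompact_realSegment (a b : ℝ) : IsCompact (realSegment a b) :=
  isCompact_Icc.image Complex.continuous_ofReal

theorem realSegment_nonempty {a b : ℝ} (h : a ≤ b) : (realSegment a b).Nonempty :=
  (Set.nonempty_Icc.2 h).image _

/-! ### Chebyshev polynomials of a segment -/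

theorem pow_le_of_forall_norm_eval_le (c : ℝ) {l : ℝ} (hl : 0 ≤ l) {p : ℂ[X]} (hp : p.Monic)
    {M : ℝ} (hM : ∀ z ∈ realSegment (c - l) (c + l), ‖p.eval z‖ ≤ M) :
    (l / 2) ^ p.natDegree ≤ M := by
  have hs : p.Splits := IsAlgClosed.splits p
  -- Each factor is `w * (z - a)` with `z = c + (l/2)(w + 1/w)`, cleared of its pole at `0`.
  set Q : ℂ → ℂ := fun w =>
    (p.roots.map fun a => ((l / 2 : ℝ) : ℂ) * (w ^ 2 + 1) + (c - a) * w).prod with hQ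
  have hQd : Differentiable ℂ Q := by
    intro w
    have : Q = fun w => (((p.roots.map fun a : ℂ => Polynomial.C ((l / 2 : ℝ) : ℂ) *
        (Polynomial.X ^ 2 + 1) + Polynomial.C ((c : ℂ) - a) * Polynomial.X).prod).eval w) := by
      funext w
      simp [hQ, Polynomial.eval_multiset_prod, Multiset.map_map]
    rw [this]
    exact (Polynomial.differentiable _) w
  have hb : ∀ w ∈ frontier (Metric.ball (0 : ℂ) 1), ‖Q w‖ ≤ M := by
    intro w hw
    rw [frontier_ball _ one_ne_zero, mem_sphere_zero_iff_norm] at hw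
    set θ := Complex.arg w
    have hwe : w = Complex.exp (θ * Complex.I) := by
      have := Complex.norm_mul_exp_arg_mul_I w
      rw [hw] at this; simpa using this.symm
    have hw0 : w ≠ 0 := by rw [hwe]; exact Complex.exp_ne_zero _
    have hcos : (w ^ 2 + 1) = w * (2 * Complex.cos θ) := by
      rw [Complex.two_cos, hwe, mul_add, ← Complex.exp_add, ← Complex.exp_add, ← Complex.exp_nat_mul]
      simp [two_mul]
    have heq : Q w = w ^ (Multiset.card p.roots) * p.eval ((c + l * Real.cos θ : ℝ) : ℂ) := by
      rw [hs.eval_eq_prod_roots, hp.leadingCoeff, one_mul]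
      rw [← Multiset.prod_replicate, ← Multiset.map_const', ← Multiset.prod_map_mul]
      refine congrArg Multiset.prod (Multiset.map_congr rfl fun a _ => ?_)
      rw [hcos]
      push_cast
      ring
    rw [heq, norm_mul, norm_pow, hw, one_pow, one_mul]
    exact hM _ ((mem_realSegment_iff hl).2 ⟨θ, rfl⟩)
  have h0 : ‖Q 0‖ ≤ M := Complex.norm_le_of_forall_mem_frontier_norm_le Metric.isBounded_ball
    hQd.diffContOnCl hb (subset_closure (Metric.mem_ball_self one_pos))
  have hQ0 : Q 0 = ((l / 2 : ℝ) : ℂ) ^ p.natDegree := by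
    simp [hQ, hs.natDegree_eq_card_roots]
  rw [hQ0, norm_pow, Complex.norm_real, Real.norm_of_nonneg (by positivity)] at h0
  exact h0

theorem exists_pow_le_norm_eval (c : ℝ) {l : ℝ} (hl : 0 ≤ l) {p : ℂ[X]} (hp : p.Monic) :
    ∃ z ∈ realSegment (c - l) (c + l), (l / 2) ^ p.natDegree ≤ ‖p.eval z‖ := by
  obtain ⟨z, hz, hmax⟩ := (isCompact_realSegment (c - l) (c + l)).exists_isMaxOn
    (realSegment_nonempty (by linarith)) (f := fun z => ‖p.eval z‖) (by fun_prop)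
  exact ⟨z, hz, pow_le_of_forall_norm_eval_le c hl hp fun w hw => hmax hw⟩

/-- These are the Chebyshev polynomials `2 (l/2)^m T_m(x/l)`, produced by the recurrence `p_{m+2} =
x p_{m+1} - (l/2)^2 p_m`. The index starts at `m = 1`, since the formula at `m = 0` gives the
non-monic constant `2`. -/
theorem exists_monic_eval_cos (l : ℝ) (n : ℕ) :
    ∃ p : ℂ[X], p.Monic ∧ p.natDegree = n + 1 ∧ ∀ θ : ℝ,
      p.eval ((l * Real.cos θ : ℝ) : ℂ) =
        ((2 * (l / 2) ^ (n + 1) * Real.cos ((n + 1) * θ) : ℝ) : ℂ) := by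
  induction n using Nat.twoStepInduction with
  | zero => exact ⟨Polynomial.X, Polynomial.monic_X, by simp, fun θ => by
      simp only [Polynomial.eval_X]; congr 1; push_cast; ring_nf⟩
  | one =>
    refine ⟨Polynomial.X ^ 2 - Polynomial.C ((l ^ 2 / 2 : ℝ) : ℂ),
      Polynomial.monic_X_pow_sub_C _ two_ne_zero, Polynomial.natDegree_X_pow_sub_C, fun θ => ?_⟩
    simp only [Polynomial.eval_sub, Polynomial.eval_pow, Polynomial.eval_X, Polynomial.eval_C]
    rw [← Complex.ofReal_pow, ← Complex.ofReal_sub]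
    congr 1
    rw [show ((1 : ℕ) + 1 : ℝ) * θ = 2 * θ by push_cast; ring, Real.cos_two_mul]
    ring
  | more n ih1 ih2 =>
    obtain ⟨p, hp, hpd, hpe⟩ := ih1
    obtain ⟨q, hq, hqd, hqe⟩ := ih2
    have hXq : (Polynomial.X * q).natDegree = n + 3 := by
      rw [Polynomial.natDegree_X_mul hq.ne_zero, hqd]
    have hlt : (Polynomial.C (((l / 2) ^ 2 : ℝ) : ℂ) * p).degree < (Polynomial.X * q).degree := by
      refine lt_of_le_of_lt (Polynomial.degree_mul_le_of_le Polynomial.degree_C_le le_rfl) ?_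
      rw [zero_add]
      rw [Polynomial.degree_eq_natDegree hp.ne_zero,
        Polynomial.degree_eq_natDegree (Polynomial.monic_X.mul hq).ne_zero, hXq, hpd]
      exact_mod_cast (by omega)
    refine ⟨Polynomial.X * q - Polynomial.C (((l / 2) ^ 2 : ℝ) : ℂ) * p,
      (Polynomial.monic_X.mul hq).sub_of_left hlt, ?_, fun θ => ?_⟩
    · rw [Polynomial.natDegree_eq_of_degree_eq (Polynomial.degree_sub_eq_left_of_degree_lt hlt),
        hXq]
    · simp only [Polynomial.eval_sub, Polynomial.eval_mul, Polynomial.eval_X, Polynomial.eval_C,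
        hpe, hqe]
      rw [← Complex.ofReal_mul, ← Complex.ofReal_mul, ← Complex.ofReal_sub]
      congr 1
      push_cast
      have h1 : ((n : ℝ) + 2 + 1) * θ = (n + 1 + 1) * θ + θ := by ring
      have h2 : ((n : ℝ) + 1) * θ = (n + 1 + 1) * θ - θ := by ring
      rw [h1, h2, Real.cos_add, Real.cos_sub]
      ring

/-- A monic polynomial of each degree whose uniform norm on the segment is at most
`2 (l / 2) ^ n`. -/
theorem exists_monic_norm_eval_le (c : ℝ) {l : ℝ} (hl : 0 ≤ l) (n : ℕ) :
    ∃ p : ℂ[X], p.Monic ∧ p.natDegree = n ∧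
      ∀ z ∈ realSegment (c - l) (c + l), ‖p.eval z‖ ≤ 2 * (l / 2) ^ n := by
  cases n with
  | zero => exact ⟨1, Polynomial.monic_one, by simp, fun z _ => by simp⟩
  | succ n =>
    obtain ⟨p, hp, hpd, hpe⟩ := exists_monic_eval_cos l n
    refine ⟨p.comp (Polynomial.X - Polynomial.C (c : ℂ)), hp.comp_X_sub_C _, ?_, ?_⟩
    · rw [Polynomial.natDegree_comp, hpd, Polynomial.natDegree_X_sub_C, mul_one]
    · intro z hz
      obtain ⟨θ, rfl⟩ := (mem_realSegment_iff hl).1 hz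
      have : ((c + l * Real.cos θ : ℝ) : ℂ) - c = ((l * Real.cos θ : ℝ) : ℂ) := by
        push_cast; ring
      rw [Polynomial.eval_comp, Polynomial.eval_sub, Polynomial.eval_X, Polynomial.eval_C, this,
        hpe, Complex.norm_real, Real.norm_eq_abs, abs_mul, abs_of_nonneg (by positivity)]
      exact mul_le_of_le_one_right (by positivity) (Real.abs_cos_le_one _)

/-! ### The Chebyshev constant of a segment -/

theorem bddAbove_norm_eval (a b : ℝ) (p : ℂ[X]) :
    BddAbove (Set.range fun z : realSegment a b => ‖p.eval (z : ℂ)‖) := by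
  have := isCompact_iff_compactSpace.1 (isCompact_realSegment a b)
  exact (isCompact_range (by fun_prop)).bddAbove

theorem pow_le_chebyshevNumber (c : ℝ) {l : ℝ} (hl : 0 ≤ l) (n : ℕ) :
    (l / 2) ^ n ≤ chebyshevNumber (realSegment (c - l) (c + l)) n := by
  refine le_ciInf fun P => ?_
  have hP := Polynomial.mem_degreeLT.1 P.2
  have hm : (Polynomial.X ^ n + (P : ℂ[X])).Monic := Polynomial.monic_X_pow_add hP
  obtain ⟨z, hz, h⟩ := exists_pow_le_norm_eval c hl hm
  rw [Polynomial.natDegree_eq_of_degree_eq_some (n := n)] at h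
  · exact h.trans (le_ciSup (bddAbove_norm_eval _ _ _) ⟨z, hz⟩)
  · rw [Polynomial.degree_add_eq_left_of_degree_lt] 
    · simp
    · simpa using hP

theorem chebyshevNumber_le (c : ℝ) {l : ℝ} (hl : 0 ≤ l) (n : ℕ) :
    chebyshevNumber (realSegment (c - l) (c + l)) n ≤ 2 * (l / 2) ^ n := by
  obtain ⟨p, hp, hpd, hpe⟩ := exists_monic_norm_eval_le c hl n
  have hdeg : p - Polynomial.X ^ n ∈ Polynomial.degreeLT ℂ n := by
    rw [Polynomial.mem_degreeLT]
    have hd : p.degree = n := by rw [Polynomial.degree_eq_natDegree hp.ne_zero, hpd]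
    rw [← hd]
    refine Polynomial.degree_sub_lt_left ?_ hp.ne_zero ?_
    · simpa using hd
    · rw [hp.leadingCoeff, Polynomial.leadingCoeff_X_pow]
  have : Nonempty (realSegment (c - l) (c + l)) :=
    (realSegment_nonempty (by linarith)).to_subtype
  refine (ciInf_le ⟨0, ?_⟩ ⟨_, hdeg⟩).trans (ciSup_le fun z => ?_)
  · rintro _ ⟨P, rfl⟩
    exact Real.iSup_nonneg fun z => norm_nonneg _
  · simpa using hpe z z.2

theorem isChebyshevConstant_realSegment (c : ℝ) {l : ℝ} (hl : 0 ≤ l) :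
    IsChebyshevConstant (realSegment (c - l) (c + l)) (l / 2) := by
  have hroot : ∀ n : ℕ, n ≠ 0 → ((l / 2) ^ n) ^ (1 / (n : ℝ)) = l / 2 := fun n hn => by
    rw [one_div, Real.pow_rpow_inv_natCast (by positivity) hn]
  have h2 : Tendsto (fun n : ℕ => (2 : ℝ) ^ (1 / (n : ℝ)) * (l / 2)) atTop (𝓝 (l / 2)) := by
    have : Tendsto (fun n : ℕ => (2 : ℝ) ^ (1 / (n : ℝ))) atTop (𝓝 ((2 : ℝ) ^ (0 : ℝ))) :=
      tendsto_const_nhds.rpow tendsto_one_div_atTop_nhds_zero_nat (Or.inl two_ne_zero)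
    simpa using this.mul_const (l / 2)
  refine tendsto_of_tendsto_of_tendsto_of_le_of_le' tendsto_const_nhds h2 ?_ ?_
  · filter_upwards [eventually_ne_atTop 0] with n hn
    rw [← hroot n hn]
    exact Real.rpow_le_rpow (by positivity) (pow_le_chebyshevNumber c hl n) (by positivity)
  · filter_upwards [eventually_ne_atTop 0] with n hn
    calc _ ≤ (2 * (l / 2) ^ n) ^ (1 / (n : ℝ)) := Real.rpow_le_rpow
          ((pow_nonneg (by positivity) n).trans (pow_le_chebyshevNumber c hl n))
          (chebyshevNumber_le c hl n) (by positivity)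
      _ = _ := by rw [Real.mul_rpow two_pos.le (by positivity), hroot n hn]

/-! ### The transfinite diameter of a segment -/

/-- Points of the segment with a large product of mutual distances, chosen greedily. -/
theorem exists_pow_le_prod_norm_sub (c : ℝ) {l : ℝ} (hl : 0 ≤ l) (n : ℕ) :
    ∃ z : Fin n → realSegment (c - l) (c + l),
      (l / 2) ^ (n * (n - 1) / 2) ≤
        ∏ i : Fin n, ∏ j ∈ Finset.Ioi i, ‖(z i : ℂ) - (z j : ℂ)‖ := by
  induction n with
  | zero => exact ⟨fun i => i.elim0, by simp⟩
  | succ n ih =>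
    obtain ⟨z, hz⟩ := ih
    -- The new point makes the monic polynomial vanishing at the previous points large; its value
    -- there is the product of the new distances.
    obtain ⟨w, hw, h⟩ := exists_pow_le_norm_eval c hl
      (Polynomial.monic_prod_X_sub_C (fun i => (z i : ℂ)) Finset.univ)
    rw [Polynomial.natDegree_finsetProd_X_sub_C_eq_card, Finset.card_univ, Fintype.card_fin,
      Polynomial.eval_prod, norm_prod] at h
    simp only [Polynomial.eval_sub, Polynomial.eval_X, Polynomial.eval_C] at h
    refine ⟨Fin.cons ⟨w, hw⟩ z, ?_⟩
    rw [Nat.triangle_succ, add_comm, pow_add, Fin.prod_univ_succ]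
    refine mul_le_mul ?_ ?_ (by positivity) (by positivity)
    · rw [Fin.prod_Ioi_zero]; simpa using h
    · refine hz.trans_eq (Finset.prod_congr rfl fun i _ => ?_)
      rw [Fin.prod_Ioi_succ]; simp

/-- Replacing monomials by monic polynomials of the same degrees does not change a Vandermonde
determinant. With Chebyshev polynomials, each of the `n!` terms of the Leibniz expansion is at most
`∏ 2 (l/2)^i`, and the crude bound `n! ≤ n^n` suffices. -/
theorem prod_norm_sub_le (c : ℝ) {l : ℝ} (hl : 0 ≤ l) {n : ℕ}
    (z : Fin n → realSegment (c - l) (c + l)) :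
    ∏ i : Fin n, ∏ j ∈ Finset.Ioi i, ‖(z i : ℂ) - (z j : ℂ)‖ ≤
      (2 * n) ^ n * (l / 2) ^ (n * (n - 1) / 2) := by
  choose p hp hpd hpe using fun i : Fin n => exists_monic_norm_eval_le c hl (i : ℕ)
  have hdet := Matrix.det_eval_matrixOfPolynomials_eq_det_vandermonde
    (fun i => (z i : ℂ)) p hpd hp
  have hprod : ∏ i : Fin n, ∏ j ∈ Finset.Ioi i, ‖(z i : ℂ) - (z j : ℂ)‖ =
      ‖(Matrix.vandermonde fun i => (z i : ℂ)).det‖ := by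
    simp only [Matrix.det_vandermonde, norm_prod]
    exact Finset.prod_congr rfl fun i _ => Finset.prod_congr rfl fun j _ => norm_sub_rev _ _
  rw [hprod, hdet, Matrix.det_apply]
  have hterm : ∀ σ : Equiv.Perm (Fin n),
      ‖Equiv.Perm.sign σ • ∏ i, Matrix.of (fun i j => (p j).eval (z i : ℂ)) (σ i) i‖ ≤
        2 ^ n * (l / 2) ^ (n * (n - 1) / 2) := fun σ => by
    have : ‖Equiv.Perm.sign σ • ∏ i, Matrix.of (fun i j => (p j).eval (z i : ℂ)) (σ i) i‖ =
        ∏ i, ‖(p i).eval (z (σ i) : ℂ)‖ := by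
      rcases Int.units_eq_one_or (Equiv.Perm.sign σ) with h | h <;> simp [h, norm_prod]
    rw [this]
    calc _ ≤ ∏ i : Fin n, (2 * (l / 2) ^ (i : ℕ)) :=
          Finset.prod_le_prod (fun _ _ => norm_nonneg _) fun i _ => hpe i _ (z (σ i)).2
      _ = _ := by
          rw [Finset.prod_mul_distrib, Finset.prod_pow_eq_pow_sum, Finset.prod_const,
            Finset.card_univ, Fintype.card_fin, Fin.sum_univ_eq_sum_range (fun i => i),
            Finset.sum_range_id]
  refine (norm_sum_le_of_le _ fun σ _ => hterm σ).trans ?_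
  rw [Finset.sum_const, Finset.card_univ, Fintype.card_perm, Fintype.card_fin, nsmul_eq_mul,
    ← mul_assoc, mul_pow, mul_comm (2 ^ n : ℝ)]
  gcongr
  exact_mod_cast Nat.factorial_le_pow n

theorem pow_rpow_two_div {x : ℝ} (hx : 0 ≤ x) {n : ℕ} (hn : 2 ≤ n) :
    (x ^ (n * (n - 1) / 2)) ^ (2 / ((n : ℝ) * ((n : ℝ) - 1))) = x := by
  have h : ((n * (n - 1) / 2 : ℕ) : ℝ) = n * (n - 1) / 2 := by
    rw [Nat.cast_div (Nat.even_mul_pred_self n).two_dvd two_ne_zero, Nat.cast_mul,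
      Nat.cast_sub (by omega)]
    simp
  have hn' : (2 : ℝ) ≤ n := by exact_mod_cast hn
  rw [← Real.rpow_natCast, ← Real.rpow_mul hx, h]
  have : (n : ℝ) - 1 ≠ 0 := by linarith
  rw [show (n * (n - 1) / 2 : ℝ) * (2 / ((n : ℝ) * (n - 1))) = 1 by field_simp, Real.rpow_one]

theorem prod_norm_sub_rpow {n : ℕ} (z : Fin n → ℂ) (s : ℝ) :
    ∏ i : Fin n, ∏ j ∈ Finset.Ioi i, ‖z i - z j‖ ^ s =
      (∏ i : Fin n, ∏ j ∈ Finset.Ioi i, ‖z i - z j‖) ^ s := by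
  rw [← Real.finsetProd_rpow _ _ fun i _ => Finset.prod_nonneg fun j _ => norm_nonneg _]
  exact Finset.prod_congr rfl fun i _ => Real.finsetProd_rpow _ _ (fun j _ => norm_nonneg _) _

theorem isTransfiniteDiameter_realSegment (c : ℝ) {l : ℝ} (hl : 0 ≤ l) :
    IsTransfiniteDiameter (realSegment (c - l) (c + l)) (l / 2) := by
  have : Nonempty (realSegment (c - l) (c + l)) :=
    (realSegment_nonempty (by linarith)).to_subtype
  have hub : ∀ n : ℕ, 2 ≤ n → ∀ z : Fin n → realSegment (c - l) (c + l),
      ∏ i : Fin n, ∏ j ∈ Finset.Ioi i,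
        ‖(z i : ℂ) - (z j : ℂ)‖ ^ (2 / ((n : ℝ) * ((n : ℝ) - 1))) ≤
      (2 * n : ℝ) ^ (2 / ((n : ℝ) - 1)) * (l / 2) := fun n hn z => by
    have hn' : (2 : ℝ) ≤ n := by exact_mod_cast hn
    have hn1 : (0 : ℝ) < n - 1 := by linarith
    rw [prod_norm_sub_rpow]
    refine (Real.rpow_le_rpow (Finset.prod_nonneg fun i _ => Finset.prod_nonneg fun j _ =>
      norm_nonneg _) (prod_norm_sub_le c hl z) (by positivity)).trans_eq ?_
    rw [Real.mul_rpow (by positivity) (by positivity), pow_rpow_two_div (by positivity) hn,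
      ← Real.rpow_natCast (2 * n : ℝ), ← Real.rpow_mul (by positivity)]
    congr 2
    field_simp
  have hlim : Tendsto (fun n : ℕ => (2 * n : ℝ) ^ (2 / ((n : ℝ) - 1)) * (l / 2)) atTop
      (𝓝 (l / 2)) := by
    -- In the variable `x = 2n` the factor is `x ^ (2 / (x/2 - 1))`, which tends to `1`.
    have h := (tendsto_rpow_div_mul_add 2 (1 / 2) (-1) (by norm_num)).comp
      (tendsto_natCast_atTop_atTop.const_mul_atTop (two_pos : (0 : ℝ) < 2))
    have h' := h.mul_const (l / 2)
    rw [one_mul] at h'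
    refine h'.congr fun n => ?_
    simp only [Function.comp_apply]
    congr 2
    ring
  refine tendsto_of_tendsto_of_tendsto_of_le_of_le' tendsto_const_nhds hlim ?_ ?_
  · filter_upwards [eventually_ge_atTop 2] with n hn
    have hn' : (2 : ℝ) ≤ n := by exact_mod_cast hn
    have hn1 : (0 : ℝ) < n - 1 := by linarith
    obtain ⟨z, hz⟩ := exists_pow_le_prod_norm_sub c hl n
    refine le_trans ?_ (le_ciSup ⟨_, by rintro _ ⟨z, rfl⟩; exact hub n hn z⟩ z)
    rw [prod_norm_sub_rpow]
    calc l / 2 = _ := (pow_rpow_two_div (by positivity) hn).symm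
      _ ≤ _ := Real.rpow_le_rpow (by positivity) hz (by positivity)
  · filter_upwards [eventually_ge_atTop 2] with n hn
    exact ciSup_le (hub n hn)

/-! ### Estimating the energy -/

theorem measurable_logKernel : Measurable fun p : ℂ × ℂ => logKernel p.1 p.2 := by
  unfold logKernel
  have : Measurable fun p : ℂ × ℂ => ‖p.1 - p.2‖ₑ := by fun_prop
  exact this.ennreal_log.neg

theorem logKernel_of_ne {z t : ℂ} (h : z ≠ t) :
    logKernel z t = ((-Real.log ‖z - t‖ : ℝ) : EReal) := by
  rw [logKernel, ← ofReal_norm,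
    ENNReal.log_ofReal_of_pos (norm_pos_iff.2 (sub_ne_zero.2 h)), EReal.coe_neg]

theorem logKernel_self (z : ℂ) : logKernel z z = ⊤ := by simp [logKernel]

theorem lintegral_neg_logKernel_ne_top {K : Set ℂ} (hK : Bornology.IsBounded K) {μ : Measure ℂ}
    [IsFiniteMeasure μ] (hμ : μ Kᶜ = 0) :
    ∫⁻ z, ∫⁻ t, (-logKernel z t).toENNReal ∂μ ∂μ ≠ ⊤ := by
  have hae : ∀ᵐ z ∂μ, z ∈ K := hμ
  set B : ℝ≥0∞ := (ENNReal.log (Metric.ediam K)).toENNReal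
  have hB : B ≠ ⊤ := by
    rw [EReal.toENNReal_ne_top_iff, Ne, ENNReal.log_eq_top_iff]
    exact hK.ediam_ne_top
  have h1 : ∀ᵐ z ∂μ, ∫⁻ t, (-logKernel z t).toENNReal ∂μ ≤ B * μ Set.univ := by
    filter_upwards [hae] with z hz
    rw [← lintegral_const]
    refine lintegral_mono_ae ?_
    filter_upwards [hae] with t ht
    refine EReal.toENNReal_le_toENNReal ?_
    rw [logKernel, neg_neg, ← edist_eq_enorm_sub]
    exact ENNReal.log_monotone (Metric.edist_le_ediam_of_mem hz ht)
  refine ((lintegral_mono_ae h1).trans_lt ?_).ne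
  rw [lintegral_const]
  finiteness

theorem le_energy {μ : Measure ℂ} [IsFiniteMeasure μ] {h : ℂ × ℂ → ℝ}
    (hint : Integrable h (μ.prod μ))
    (hle : ∀ᵐ p ∂μ.prod μ, (h p : EReal) ≤ logKernel p.1 p.2)
    (hN : ∫⁻ z, ∫⁻ t, (-logKernel z t).toENNReal ∂μ ∂μ ≠ ⊤) :
    ((∫ p, h p ∂μ.prod μ : ℝ) : EReal) ≤ energy μ := by
  -- This is `r⁺ - r⁻ ≤ x⁺ - x⁻` with negative parts transposed, so that it can be integrated in
  -- `ℝ≥0∞` without subtraction.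
  have hptw : ∀ (x : EReal) (r : ℝ), (r : EReal) ≤ x →
      ENNReal.ofReal r + (-x).toENNReal ≤ x.toENNReal + ENNReal.ofReal (-r) := by
    intro x r hrx
    induction x with
    | bot => simp at hrx
    | top => simp
    | coe x =>
      have hrx : r ≤ x := by exact_mod_cast hrx
      rw [← EReal.coe_neg, EReal.real_coe_toENNReal, EReal.real_coe_toENNReal]
      gcongr
  have hm : Measurable fun p : ℂ × ℂ => (-logKernel p.1 p.2).toENNReal :=
    measurable_logKernel.neg.ereal_toENNReal
  have hP : ∫⁻ z, ∫⁻ t, (logKernel z t).toENNReal ∂μ ∂μ =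
      ∫⁻ p, (logKernel p.1 p.2).toENNReal ∂μ.prod μ :=
    (lintegral_prod _ measurable_logKernel.ereal_toENNReal.aemeasurable).symm
  have hN' : ∫⁻ z, ∫⁻ t, (-logKernel z t).toENNReal ∂μ ∂μ =
      ∫⁻ p, (-logKernel p.1 p.2).toENNReal ∂μ.prod μ :=
    (lintegral_prod _ hm.aemeasurable).symm
  have key : ∫⁻ p, ENNReal.ofReal (h p) ∂μ.prod μ + ∫⁻ p, (-logKernel p.1 p.2).toENNReal ∂μ.prod μ ≤
      ∫⁻ p, (logKernel p.1 p.2).toENNReal ∂μ.prod μ + ∫⁻ p, ENNReal.ofReal (-h p) ∂μ.prod μ := by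
    rw [← lintegral_add_right _ hm,
      ← lintegral_add_left measurable_logKernel.ereal_toENNReal]
    refine lintegral_mono_ae ?_
    filter_upwards [hle] with p hp using hptw _ _ hp
  have h1 : ∫⁻ p, ENNReal.ofReal (h p) ∂μ.prod μ ≠ ⊤ := hint.lintegral_lt_top.ne
  have h2 : ∫⁻ p, ENNReal.ofReal (-h p) ∂μ.prod μ ≠ ⊤ := hint.neg.lintegral_lt_top.ne
  rw [energy, hP, hN', integral_eq_lintegral_pos_part_sub_lintegral_neg_part hint]
  rw [hN'] at hN
  generalize (∫⁻ p, ENNReal.ofReal (h p) ∂μ.prod μ) = A at *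
  generalize (∫⁻ p, ENNReal.ofReal (-h p) ∂μ.prod μ) = B at *
  generalize (∫⁻ p, (logKernel p.1 p.2).toENNReal ∂μ.prod μ) = P at *
  generalize (∫⁻ p, (-logKernel p.1 p.2).toENNReal ∂μ.prod μ) = N at *
  lift A to NNReal using h1
  lift B to NNReal using h2
  lift N to NNReal using hN
  induction P with
  | top => simp
  | coe P =>
    have key : A + N ≤ P + B := by exact_mod_cast key
    have key : (A : ℝ) + N ≤ P + B := by exact_mod_cast key
    have : (A : ℝ) - B ≤ P - N := by linarith
    rw [EReal.coe_nnreal_eq_coe_real, EReal.coe_nnreal_eq_coe_real, ← EReal.coe_sub,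
      ENNReal.coe_toReal, ENNReal.coe_toReal]
    exact EReal.coe_le_coe_iff.2 this

/-- The hypothesis says that the potential is `C` almost everywhere, in subtraction-free form;
integrating it against `μ` gives the energy. -/
theorem energy_eq_of_potential_eq {μ : Measure ℂ} [IsProbabilityMeasure μ] {C : ℝ}
    (hC : ∀ᵐ z ∂μ, ∫⁻ t, (logKernel z t).toENNReal ∂μ + ENNReal.ofReal (-C) =
      ∫⁻ t, (-logKernel z t).toENNReal ∂μ + ENNReal.ofReal C)
    (hN : ∫⁻ z, ∫⁻ t, (-logKernel z t).toENNReal ∂μ ∂μ ≠ ⊤) : energy μ = C := by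
  have key := lintegral_congr_ae hC
  rw [lintegral_add_right _ measurable_const, lintegral_add_right _ measurable_const,
    lintegral_const, lintegral_const, measure_univ, mul_one, mul_one] at key
  rw [energy]
  generalize (∫⁻ z, ∫⁻ t, (logKernel z t).toENNReal ∂μ ∂μ) = P at *
  generalize (∫⁻ z, ∫⁻ t, (-logKernel z t).toENNReal ∂μ ∂μ) = N at *
  lift N to NNReal using hN
  have hPt : P ≠ ⊤ := by
    rintro rfl
    exact ENNReal.add_ne_top.2 ⟨ENNReal.coe_ne_top, ENNReal.ofReal_ne_top⟩ (by rw [← key, top_add])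
  lift P to NNReal using hPt
  have key := congrArg ENNReal.toReal key
  rw [ENNReal.toReal_add (by simp) (by simp), ENNReal.toReal_add (by simp) (by simp),
    ENNReal.toReal_ofReal', ENNReal.toReal_ofReal'] at key
  have : (P : ℝ) - N = C := by
    simp only [ENNReal.coe_toReal] at key
    rcases max_cases (-C) 0 with h | h <;> rcases max_cases C 0 with h' | h' <;> linarith
  rw [EReal.coe_nnreal_eq_coe_real, EReal.coe_nnreal_eq_coe_real, ← EReal.coe_sub, this]

/-! ### The logarithmic kernel on a segment in the cosine parametrization -/

theorem norm_one_sub_mul_exp_sq (r α : ℝ) :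
    ‖1 - (r : ℂ) * Complex.exp (α * Complex.I)‖ ^ 2 = 1 - 2 * r * Real.cos α + r ^ 2 := by
  rw [← Complex.normSq_eq_norm_sq, Complex.normSq_apply]
  simp [Complex.exp_ofReal_mul_I_re, Complex.exp_ofReal_mul_I_im]
  linear_combination r ^ 2 * Real.sin_sq_add_cos_sq α

theorem norm_ofReal_mul_exp {r : ℝ} (hr0 : 0 ≤ r) (α : ℝ) :
    ‖(r : ℂ) * Complex.exp (α * Complex.I)‖ = r := by
  rw [norm_mul, Complex.norm_exp_ofReal_mul_I, mul_one, Complex.norm_of_nonneg hr0]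

/-- Real part of the series of `-log (1 - z)`. The term `n = 0` vanishes because `r ^ 0 / 0 = 0`. -/
theorem hasSum_neg_log_norm_one_sub {r : ℝ} (hr0 : 0 ≤ r) (hr1 : r < 1) (α : ℝ) :
    HasSum (fun n : ℕ => r ^ n / n * Real.cos (n * α))
      (-Real.log ‖1 - (r : ℂ) * Complex.exp (α * Complex.I)‖) := by
  have hz : ‖(r : ℂ) * Complex.exp (α * Complex.I)‖ < 1 := by rwa [norm_ofReal_mul_exp hr0]
  have h := Complex.hasSum_re (Complex.hasSum_taylorSeries_neg_log hz)
  rw [Complex.neg_re, Complex.log_re] at h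
  convert h using 2 with n
  rw [mul_pow, ← Complex.exp_nat_mul, ← mul_assoc, ← Complex.ofReal_natCast,
    ← Complex.ofReal_mul, ← Complex.ofReal_pow, mul_div_right_comm, ← Complex.ofReal_div,
    Complex.re_ofReal_mul, Complex.exp_ofReal_mul_I_re]

theorem hasSum_regularized_kernel {r : ℝ} (hr0 : 0 ≤ r) (hr1 : r < 1) (θ φ : ℝ) :
    HasSum (fun n : ℕ => 2 * (r ^ n / n) * (Real.cos (n * θ) * Real.cos (n * φ)))
      (-Real.log ‖1 - (r : ℂ) * Complex.exp ((θ - φ : ℝ) * Complex.I)‖ -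
        Real.log ‖1 - (r : ℂ) * Complex.exp ((θ + φ : ℝ) * Complex.I)‖) := by
  convert (hasSum_neg_log_norm_one_sub hr0 hr1 (θ - φ)).add
    (hasSum_neg_log_norm_one_sub hr0 hr1 (θ + φ)) using 2 with n
  · rw [mul_sub, mul_add, Real.cos_sub, Real.cos_add]
    ring
  · ring

/-- With `u = exp (iα)`, `|1 - r u|² - r |1 - u|² = (1 - r)² ≥ 0`. Applied at `α = θ ± φ`, where the
two `|1 - u|` multiply to `2 |cos θ - cos φ|`, this costs only `log r`, which disappears as `r → 1`.
-/
theorem regularized_kernel_le {l r : ℝ} (hl : 0 < l) (hr0 : 0 < r) (hr1 : r < 1) {θ φ : ℝ}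
    (h : Real.cos θ ≠ Real.cos φ) :
    -Real.log (l / 2) + Real.log r +
      (-Real.log ‖1 - (r : ℂ) * Complex.exp ((θ - φ : ℝ) * Complex.I)‖ -
        Real.log ‖1 - (r : ℂ) * Complex.exp ((θ + φ : ℝ) * Complex.I)‖) ≤
    -Real.log |l * Real.cos θ - l * Real.cos φ| := by
  have hpos : ∀ α : ℝ, 0 < ‖1 - (r : ℂ) * Complex.exp (α * Complex.I)‖ := fun α => by
    rw [norm_pos_iff, sub_ne_zero]
    intro h1
    have := norm_ofReal_mul_exp hr0.le α
    rw [← h1, norm_one] at this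
    linarith
  have h1 := norm_one_sub_mul_exp_sq r (θ - φ)
  have h2 := norm_one_sub_mul_exp_sq r (θ + φ)
  have p1 := hpos (θ - φ)
  have p2 := hpos (θ + φ)
  generalize ‖1 - (r : ℂ) * Complex.exp ((θ - φ : ℝ) * Complex.I)‖ = N₁ at *
  generalize ‖1 - (r : ℂ) * Complex.exp ((θ + φ : ℝ) * Complex.I)‖ = N₂ at *
  have hd : 0 < |Real.cos θ - Real.cos φ| := abs_pos.2 (sub_ne_zero.2 h)
  have hprod : r * (2 * |Real.cos θ - Real.cos φ|) ≤ N₁ * N₂ := by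
    refine abs_le_of_sq_le_sq' ?_ (by positivity) |>.2
    have e1 : r * (2 - 2 * Real.cos (θ - φ)) ≤ N₁ ^ 2 := by rw [h1]; nlinarith [sq_nonneg (1 - r)]
    have e2 : r * (2 - 2 * Real.cos (θ + φ)) ≤ N₂ ^ 2 := by rw [h2]; nlinarith [sq_nonneg (1 - r)]
    calc (r * (2 * |Real.cos θ - Real.cos φ|)) ^ 2
        = r ^ 2 * 4 * (Real.cos θ - Real.cos φ) ^ 2 := by
          rw [← sq_abs (Real.cos θ - Real.cos φ)]; ring
      _ = (r * (2 - 2 * Real.cos (θ - φ))) * (r * (2 - 2 * Real.cos (θ + φ))) := by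
          rw [Real.cos_sub, Real.cos_add]
          have : Real.sin θ ^ 2 * Real.sin φ ^ 2 = (1 - Real.cos θ ^ 2) * (1 - Real.cos φ ^ 2) := by
            rw [← Real.sin_sq, ← Real.sin_sq]
          linear_combination 4 * r ^ 2 * this
      _ ≤ N₁ ^ 2 * N₂ ^ 2 := by
          refine mul_le_mul e1 e2 (mul_nonneg hr0.le ?_) (by positivity)
          linarith [Real.cos_le_one (θ + φ)]
      _ = _ := by ring
  have hlog := Real.log_le_log (by positivity) hprod
  rw [Real.log_mul hr0.ne' (by positivity), Real.log_mul two_ne_zero hd.ne',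
    Real.log_mul p1.ne' p2.ne'] at hlog
  rw [← mul_sub, abs_mul, abs_of_pos hl, Real.log_mul hl.ne' hd.ne',
    Real.log_div hl.ne' two_ne_zero]
  linarith

theorem neg_log_le_energy (c : ℝ) {l : ℝ} (hl : 0 < l) {μ : Measure ℂ} [IsProbabilityMeasure μ]
    (hμ : μ (realSegment (c - l) (c + l))ᶜ = 0) :
    ((-Real.log (l / 2) : ℝ) : EReal) ≤ energy μ := by
  have hae : ∀ᵐ z ∂μ, z ∈ realSegment (c - l) (c + l) := hμ
  set T : ℂ → ℝ := fun z => Real.arccos ((z.re - c) / l) with hT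
  have hTm : Measurable T := by
    have : Continuous T := Real.continuous_arccos.comp (by fun_prop)
    exact this.measurable
  have hTz : ∀ z ∈ realSegment (c - l) (c + l), z = ((c + l * Real.cos (T z) : ℝ) : ℂ) := by
    rintro _ ⟨x, ⟨h1, h2⟩, rfl⟩
    simp only [hT, Complex.ofReal_re]
    rw [Real.cos_arccos]
    · congr 1; field_simp; ring
    · rw [le_div_iff₀ hl]; linarith
    · rw [div_le_iff₀ hl]; linarith
  have hr : ∀ r : ℝ, 0 < r → r < 1 →
      ((-Real.log (l / 2) + Real.log r : ℝ) : EReal) ≤ energy μ := fun r hr0 hr1 => by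
    set F : ℕ → ℂ × ℂ → ℝ := fun n p =>
      2 * (r ^ n / n) * (Real.cos (n * T p.1) * Real.cos (n * T p.2)) with hF
    set G : ℂ × ℂ → ℝ := fun p =>
      -Real.log ‖1 - (r : ℂ) * Complex.exp ((T p.1 - T p.2 : ℝ) * Complex.I)‖ -
        Real.log ‖1 - (r : ℂ) * Complex.exp ((T p.1 + T p.2 : ℝ) * Complex.I)‖ with hG
    have hFG : ∀ p, HasSum (fun n => F n p) (G p) := fun p =>
      hasSum_regularized_kernel hr0.le hr1 _ _
    have hFb : ∀ n p, ‖F n p‖ ≤ 2 * r ^ n := fun n p => by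
      rw [hF, Real.norm_eq_abs, abs_mul, abs_mul _ (Real.cos _),
        abs_of_nonneg (mul_nonneg two_pos.le (div_nonneg (pow_nonneg hr0.le n) n.cast_nonneg))]
      have h1 : |Real.cos (n * T p.1)| * |Real.cos (n * T p.2)| ≤ 1 :=
        mul_le_one₀ (Real.abs_cos_le_one _) (abs_nonneg _) (Real.abs_cos_le_one _)
      have h2 : r ^ n / n ≤ r ^ n := by
        rcases Nat.eq_zero_or_pos n with rfl | hn
        · simp
        · exact div_le_self (by positivity) (by exact_mod_cast hn)
      calc _ ≤ 2 * r ^ n * 1 := by gcongr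
        _ = _ := mul_one _
    have hsum : Summable fun n : ℕ => 2 * r ^ n :=
      (summable_geometric_of_lt_one hr0.le hr1).mul_left 2
    have hFm : ∀ n, Measurable (F n) := fun n => by
      simp only [hF]; fun_prop
    have hGm : Measurable G := by simp only [hG]; fun_prop
    have hFi : ∀ n, Integrable (F n) (μ.prod μ) := fun n =>
      Integrable.of_bound (hFm n).aestronglyMeasurable _ (ae_of_all _ (hFb n))
    have hGi : Integrable G (μ.prod μ) :=
      Integrable.of_bound hGm.aestronglyMeasurable (∑' n : ℕ, 2 * r ^ n) (ae_of_all _ fun p => by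
        rw [← (hFG p).tsum_eq]
        exact tsum_of_norm_bounded hsum.hasSum fun n => hFb n p)
    -- Positive definiteness: integrated termwise, the series has terms `2 (r^n / n) (∫ cos (n T)
    -- dμ)²`.
    have hGint : 0 ≤ ∫ p, G p ∂μ.prod μ := by
      have h := hasSum_integral_of_summable_integral_norm hFi
        (hsum.of_nonneg_of_le (fun n => integral_nonneg fun p => norm_nonneg _) fun n => by
          simpa using integral_mono_of_nonneg (μ := μ.prod μ) (ae_of_all _ fun p => norm_nonneg _)
            (integrable_const (2 * r ^ n)) (ae_of_all _ (hFb n)))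
      simp only [fun p => (hFG p).tsum_eq] at h
      refine h.nonneg fun n => ?_
      simp only [hF]
      rw [integral_const_mul, integral_prod_mul (fun z => Real.cos (n * T z))
        (fun z => Real.cos (n * T z))]
      exact mul_nonneg (by positivity) (mul_self_nonneg _)
    have hN := lintegral_neg_logKernel_ne_top (isCompact_realSegment _ _).isBounded hμ
    have hle := le_energy (h := fun p => -Real.log (l / 2) + Real.log r + G p)
      ((integrable_const _).add hGi) ?_ hN
    · refine le_trans ?_ hle
      rw [integral_add (integrable_const _) hGi, integral_const, probReal_univ, one_smul]
      exact EReal.coe_le_coe_iff.2 (le_add_of_nonneg_right hGint)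
    · have h1 := Measure.quasiMeasurePreserving_fst (μ := μ) (ν := μ) |>.ae hae
      have h2 := Measure.quasiMeasurePreserving_snd (μ := μ) (ν := μ) |>.ae hae
      filter_upwards [h1, h2] with p hp1 hp2
      by_cases hp : p.1 = p.2
      · rw [hp, logKernel_self]; exact le_top
      rw [logKernel_of_ne hp, EReal.coe_le_coe_iff]
      have e1 := hTz _ hp1
      have e2 := hTz _ hp2
      have hne : Real.cos (T p.1) ≠ Real.cos (T p.2) := fun h => hp (by rw [e1, e2, h])
      have hd : ‖p.1 - p.2‖ = |l * Real.cos (T p.1) - l * Real.cos (T p.2)| := by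
        conv_lhs => rw [e1, e2]
        rw [← Complex.ofReal_sub, Complex.norm_real, Real.norm_eq_abs]
        congr 1; ring
      rw [hd]
      exact regularized_kernel_le hl hr0 hr1 hne
  have hlim : Tendsto (fun r : ℝ => ((-Real.log (l / 2) + Real.log r : ℝ) : EReal)) (𝓝[<] 1)
      (𝓝 ((-Real.log (l / 2) : ℝ) : EReal)) := by
    refine (continuous_coe_real_ereal.tendsto _).comp ?_
    have : Tendsto Real.log (𝓝[<] 1) (𝓝 0) := by
      simpa using (Real.continuousAt_log one_ne_zero).tendsto.mono_left nhdsWithin_le_nhds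
    simpa using this.const_add (-Real.log (l / 2))
  refine le_of_tendsto hlim ?_
  filter_upwards [Ioo_mem_nhdsLT (zero_lt_one (α := ℝ))] with r hr' using hr r hr'.1 hr'.2

/-! ### The arcsine measure -/

/-- The normalized angular measure on `(0, 2π]`. -/
noncomputable def angleMeasure : Measure ℝ :=
  ENNReal.ofReal (2 * Real.pi)⁻¹ • volume.restrict (Set.Ioc 0 (2 * Real.pi))

instance : IsProbabilityMeasure angleMeasure := by
  constructor
  rw [angleMeasure, Measure.smul_apply, Measure.restrict_apply_univ, Real.volume_Ioc, sub_zero,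
    smul_eq_mul, ← ENNReal.ofReal_mul (by positivity), inv_mul_cancel₀ (by positivity),
    ENNReal.ofReal_one]

/-- The arcsine distribution of the segment with centre `c` and half-length `l`. -/
noncomputable def arcsineMeasure (c l : ℝ) : Measure ℂ :=
  angleMeasure.map fun θ => ((c + l * Real.cos θ : ℝ) : ℂ)

theorem measurable_cosMap (c l : ℝ) :
    Measurable fun θ : ℝ => ((c + l * Real.cos θ : ℝ) : ℂ) := by fun_prop

instance (c l : ℝ) : IsProbabilityMeasure (arcsineMeasure c l) :=
  Measure.isProbabilityMeasure_map (measurable_cosMap c l).aemeasurable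

theorem arcsineMeasure_compl_realSegment (c : ℝ) {l : ℝ} (hl : 0 ≤ l) :
    arcsineMeasure c l (realSegment (c - l) (c + l))ᶜ = 0 := by
  rw [arcsineMeasure, Measure.map_apply (measurable_cosMap c l)
    (isCompact_realSegment _ _).measurableSet.compl]
  convert measure_empty (μ := angleMeasure)
  rw [Set.preimage_compl, Set.compl_empty_iff, Set.eq_univ_iff_forall]
  exact fun θ => (mem_realSegment_iff hl).2 ⟨θ, rfl⟩

theorem integrable_log_norm_exp_sub (a : ℂ) :
    Integrable (fun θ : ℝ => Real.log ‖Complex.exp (θ * Complex.I) - a‖) angleMeasure := by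
  have h := circleIntegrable_log_norm_sub_const (a := a) (c := 0) 1
  have h' := (intervalIntegrable_iff_integrableOn_Ioc_of_le (by positivity)).1 h
  simp only [circleMap_zero, Complex.ofReal_one, one_mul] at h'
  exact Integrable.smul_measure h' ENNReal.ofReal_ne_top

theorem integral_log_norm_exp_sub {a : ℂ} (ha : ‖a‖ = 1) :
    ∫ θ : ℝ, Real.log ‖Complex.exp (θ * Complex.I) - a‖ ∂angleMeasure = 0 := by
  have h := circleAverage_log_norm_sub_const₁ ha
  rw [Real.circleAverage_def, intervalIntegral.integral_of_le (by positivity)] at h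
  simp only [circleMap_zero, Complex.ofReal_one, one_mul] at h
  rw [angleMeasure, integral_smul_measure, ENNReal.toReal_ofReal (by positivity)]
  exact h

theorem ae_exp_ne (a : ℂ) : ∀ᵐ θ : ℝ ∂angleMeasure, Complex.exp (θ * Complex.I) ≠ a := by
  have h : ∀ᵐ θ : ℝ, Complex.exp (θ * Complex.I) ≠ a := by
    have hc := (Set.countable_singleton a).preimage_circleMap 0 one_ne_zero
    refine (measure_mono_null ?_ (hc.measure_zero volume) : _)
    intro θ hθ
    simpa [circleMap] using hθ
  exact Measure.smul_absolutelyContinuous.ae_le (ae_restrict_of_ae h)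

/-- Norms in `2w (cos θ - cos φ) = (w - exp (iφ)) (w - exp (-iφ))`, `w = exp (iθ)`. It splits the
potential into two logarithms with poles on the unit circle. -/
theorem norm_cos_sub_cos {l : ℝ} (hl : 0 ≤ l) (θ φ : ℝ) :
    |l * Real.cos φ - l * Real.cos θ| = l / 2 *
      (‖Complex.exp (θ * Complex.I) - Complex.exp (φ * Complex.I)‖ *
        ‖Complex.exp (θ * Complex.I) - Complex.exp ((-φ : ℝ) * Complex.I)‖) := by
  have h1 : Complex.exp (θ * Complex.I) * Complex.exp (-θ * Complex.I) = 1 := by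
    rw [← Complex.exp_add]; simp
  have h2 : Complex.exp (φ * Complex.I) * Complex.exp (-φ * Complex.I) = 1 := by
    rw [← Complex.exp_add]; simp
  have key : Complex.exp (θ * Complex.I) * ((l * Real.cos θ - l * Real.cos φ : ℝ) : ℂ) =
      ((l / 2 : ℝ) : ℂ) * ((Complex.exp (θ * Complex.I) - Complex.exp (φ * Complex.I)) *
        (Complex.exp (θ * Complex.I) - Complex.exp ((-φ : ℝ) * Complex.I))) := by
    push_cast
    rw [Complex.cos, Complex.cos]
    linear_combination (l / 2 : ℂ) * (h1 - h2)
  have := congrArg norm key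
  rwa [norm_mul, norm_mul, norm_mul, Complex.norm_exp_ofReal_mul_I, one_mul, Complex.norm_real,
    Complex.norm_real, Real.norm_eq_abs, Real.norm_of_nonneg (by positivity), abs_sub_comm] at this

theorem measurable_logKernel_right (z : ℂ) : Measurable (logKernel z) := by
  unfold logKernel
  have : Measurable fun t : ℂ => ‖z - t‖ₑ := by fun_prop
  exact this.ennreal_log.neg

theorem logKernel_cos_ae_eq (c : ℝ) {l : ℝ} (hl : 0 < l) (φ : ℝ) :
    ∀ᵐ θ ∂angleMeasure, logKernel ((c + l * Real.cos φ : ℝ) : ℂ) ((c + l * Real.cos θ : ℝ) : ℂ) =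
      ((-Real.log (l / 2) -
        Real.log ‖Complex.exp (θ * Complex.I) - Complex.exp (φ * Complex.I)‖ -
        Real.log ‖Complex.exp (θ * Complex.I) - Complex.exp ((-φ : ℝ) * Complex.I)‖ : ℝ) :
          EReal) := by
  filter_upwards [ae_exp_ne (Complex.exp (φ * Complex.I)),
    ae_exp_ne (Complex.exp ((-φ : ℝ) * Complex.I))] with θ h1 h2
  have p1 := norm_pos_iff.2 (sub_ne_zero.2 h1)
  have p2 := norm_pos_iff.2 (sub_ne_zero.2 h2)
  have hn : ‖((c + l * Real.cos φ : ℝ) : ℂ) - ((c + l * Real.cos θ : ℝ) : ℂ)‖ = l / 2 *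
    (‖Complex.exp (θ * Complex.I) - Complex.exp (φ * Complex.I)‖ *
      ‖Complex.exp (θ * Complex.I) - Complex.exp ((-φ : ℝ) * Complex.I)‖) := by
    rw [← Complex.ofReal_sub, Complex.norm_real, Real.norm_eq_abs, add_sub_add_left_eq_sub,
      norm_cos_sub_cos hl.le]
  rw [logKernel_of_ne, hn, Real.log_mul (by positivity) (by positivity),
    Real.log_mul p1.ne' p2.ne']
  · congr 1; ring
  · rw [← sub_ne_zero, ← norm_pos_iff, hn]; positivity

theorem lintegral_toENNReal_add_eq {α : Type*} [MeasurableSpace α] {ν : Measure α}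
    {k : α → EReal} {u : α → ℝ} (hu : Integrable u ν) (hk : ∀ᵐ x ∂ν, k x = (u x : EReal)) :
    ∫⁻ x, (k x).toENNReal ∂ν + ENNReal.ofReal (-∫ x, u x ∂ν) =
      ∫⁻ x, (-k x).toENNReal ∂ν + ENNReal.ofReal (∫ x, u x ∂ν) := by
  have e1 : ∫⁻ x, (k x).toENNReal ∂ν = ∫⁻ x, ENNReal.ofReal (u x) ∂ν := by
    refine lintegral_congr_ae ?_
    filter_upwards [hk] with x h
    rw [h, EReal.real_coe_toENNReal]
  have e2 : ∫⁻ x, (-k x).toENNReal ∂ν = ∫⁻ x, ENNReal.ofReal (-u x) ∂ν := by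
    refine lintegral_congr_ae ?_
    filter_upwards [hk] with x h
    rw [h, ← EReal.coe_neg, EReal.real_coe_toENNReal]
  have h1 : ∫⁻ x, ENNReal.ofReal (u x) ∂ν ≠ ⊤ := hu.lintegral_lt_top.ne
  have h2 : ∫⁻ x, ENNReal.ofReal (-u x) ∂ν ≠ ⊤ := hu.neg.lintegral_lt_top.ne
  rw [e1, e2, integral_eq_lintegral_pos_part_sub_lintegral_neg_part hu]
  generalize (∫⁻ x, ENNReal.ofReal (u x) ∂ν) = P at *
  generalize (∫⁻ x, ENNReal.ofReal (-u x) ∂ν) = N at *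
  rw [← ENNReal.toReal_eq_toReal_iff' (ENNReal.add_ne_top.2 ⟨h1, ENNReal.ofReal_ne_top⟩)
    (ENNReal.add_ne_top.2 ⟨h2, ENNReal.ofReal_ne_top⟩), ENNReal.toReal_add h1 ENNReal.ofReal_ne_top,
    ENNReal.toReal_add h2 ENNReal.ofReal_ne_top, ENNReal.toReal_ofReal', ENNReal.toReal_ofReal']
  rcases max_cases (-(P.toReal - N.toReal)) 0 with h | h <;>
    rcases max_cases (P.toReal - N.toReal) 0 with h' | h' <;> linarith

theorem lintegral_arcsineMeasure (c l : ℝ) {f : ℂ → ℝ≥0∞} (hf : Measurable f) :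
    ∫⁻ t, f t ∂arcsineMeasure c l =
      ∫⁻ θ, f ((c + l * Real.cos θ : ℝ) : ℂ) ∂angleMeasure :=
  lintegral_map hf (measurable_cosMap c l)

theorem integral_potential_cos (C φ : ℝ) :
    Integrable (fun θ : ℝ => C -
        Real.log ‖Complex.exp (θ * Complex.I) - Complex.exp (φ * Complex.I)‖ -
        Real.log ‖Complex.exp (θ * Complex.I) - Complex.exp ((-φ : ℝ) * Complex.I)‖)
      angleMeasure ∧
    ∫ θ : ℝ, (C -
        Real.log ‖Complex.exp (θ * Complex.I) - Complex.exp (φ * Complex.I)‖ -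
        Real.log ‖Complex.exp (θ * Complex.I) - Complex.exp ((-φ : ℝ) * Complex.I)‖)
      ∂angleMeasure = C := by
  have i1 := integrable_log_norm_exp_sub (Complex.exp (φ * Complex.I))
  have i2 := integrable_log_norm_exp_sub (Complex.exp ((-φ : ℝ) * Complex.I))
  have i0 : Integrable (fun _ : ℝ => C) angleMeasure := integrable_const _
  refine ⟨(i0.sub i1).sub i2, ?_⟩
  have i01 : Integrable (fun θ : ℝ => C -
      Real.log ‖Complex.exp (θ * Complex.I) - Complex.exp (φ * Complex.I)‖) angleMeasure :=
    i0.sub i1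
  rw [integral_sub i01 i2, integral_sub i0 i1, integral_log_norm_exp_sub (Complex.norm_exp_ofReal_mul_I _),
    integral_log_norm_exp_sub (Complex.norm_exp_ofReal_mul_I _), integral_const, probReal_univ,
    one_smul, sub_zero, sub_zero]

theorem potential_arcsineMeasure (c : ℝ) {l : ℝ} (hl : 0 < l) (φ : ℝ) :
    ∫⁻ t, (logKernel ((c + l * Real.cos φ : ℝ) : ℂ) t).toENNReal ∂arcsineMeasure c l +
        ENNReal.ofReal (- -Real.log (l / 2)) =
      ∫⁻ t, (-logKernel ((c + l * Real.cos φ : ℝ) : ℂ) t).toENNReal ∂arcsineMeasure c l +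
        ENNReal.ofReal (-Real.log (l / 2)) := by
  have hm : Measurable (logKernel ((c + l * Real.cos φ : ℝ) : ℂ)) := measurable_logKernel_right _
  have hm' : Measurable fun t => (-logKernel ((c + l * Real.cos φ : ℝ) : ℂ) t).toENNReal :=
    hm.neg.ereal_toENNReal
  rw [lintegral_arcsineMeasure c l hm.ereal_toENNReal, lintegral_arcsineMeasure c l hm']
  obtain ⟨hi, hint⟩ := integral_potential_cos (-Real.log (l / 2)) φ
  have h := lintegral_toENNReal_add_eq hi (logKernel_cos_ae_eq c hl φ)
  rwa [hint] at h

theorem energy_arcsineMeasure (c : ℝ) {l : ℝ} (hl : 0 < l) :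
    energy (arcsineMeasure c l) = ((-Real.log (l / 2) : ℝ) : EReal) := by
  have hsupp := arcsineMeasure_compl_realSegment c hl.le
  refine energy_eq_of_potential_eq ?_
    (lintegral_neg_logKernel_ne_top (isCompact_realSegment _ _).isBounded hsupp)
  have hae : ∀ᵐ z ∂arcsineMeasure c l, z ∈ realSegment (c - l) (c + l) := hsupp
  refine hae.mono fun z hz => ?_
  obtain ⟨φ, h⟩ := (mem_realSegment_iff hl.le).1 hz
  rw [h]
  exact potential_arcsineMeasure c hl φ

/-! ### The logarithmic capacity of a segment -/

theorem exp_neg_neg_log {l : ℝ} (hl : 0 < l) :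
    EReal.exp (-((-Real.log (l / 2) : ℝ) : EReal)) = ENNReal.ofReal (l / 2) := by
  rw [← EReal.coe_neg, neg_neg, EReal.exp_coe, Real.exp_log (by positivity)]

/-- Comparison with a longer segment also covers a single point, where the energy bound, which needs
positive length, does not apply directly; there `l'` is sent to `0`. -/
theorem logCapacity_le (c : ℝ) {l l' : ℝ} (hll : l ≤ l') (hl' : 0 < l') :
    logCapacity (realSegment (c - l) (c + l)) ≤ ENNReal.ofReal (l' / 2) := by
  rw [← exp_neg_neg_log hl', logCapacity, EReal.exp_le_exp_iff, EReal.neg_le_neg_iff]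
  refine le_sInf ?_
  rintro _ ⟨μ, hμ, hμK, rfl⟩
  refine neg_log_le_energy c hl' (measure_mono_null (Set.compl_subset_compl.2 ?_) hμK)
  exact Set.image_mono (Set.Icc_subset_Icc (by linarith) (by linarith))

theorem logCapacity_realSegment (c : ℝ) {l : ℝ} (hl : 0 ≤ l) :
    logCapacity (realSegment (c - l) (c + l)) = ENNReal.ofReal (l / 2) := by
  rcases hl.eq_or_lt with rfl | hl
  · have hlim : Tendsto (fun x : ℝ => ENNReal.ofReal (x / 2)) (𝓝[>] 0)
        (𝓝 (ENNReal.ofReal (0 / 2))) :=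
      ((ENNReal.continuous_ofReal.comp (continuous_id.div_const 2)).tendsto 0).mono_left
        nhdsWithin_le_nhds
    refine le_antisymm (ge_of_tendsto hlim ?_) (by simp)
    filter_upwards [self_mem_nhdsWithin] with x hx using logCapacity_le c (le_of_lt hx) hx
  · refine le_antisymm (logCapacity_le c le_rfl hl) ?_
    rw [← exp_neg_neg_log hl, logCapacity, EReal.exp_le_exp_iff, EReal.neg_le_neg_iff]
    exact sInf_le ⟨arcsineMeasure c l, inferInstance, arcsineMeasure_compl_realSegment c hl.le,
      (energy_arcsineMeasure c hl).symm⟩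

end PlanarCapacity

theorem mainTheorem11 (a b l : ℝ) (hl : 0 ≤ l) (hab : b - a = 2 * l) :
    PlanarCapacity.logCapacity (PlanarCapacity.realSegment a b) = ENNReal.ofReal (l / 2) ∧
    PlanarCapacity.IsTransfiniteDiameter (PlanarCapacity.realSegment a b) (l / 2) ∧
    PlanarCapacity.IsChebyshevConstant (PlanarCapacity.realSegment a b) (l / 2) ∧
    (PlanarCapacity.logCapacity (PlanarCapacity.realSegment a b) < 1 ↔ b - a < 4) ∧
    (PlanarCapacity.logCapacity (PlanarCapacity.realSegment a b) = 1 ↔ b - a = 4) ∧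
    (1 < PlanarCapacity.logCapacity (PlanarCapacity.realSegment a b) ↔ 4 < b - a) := by
  obtain ⟨c, rfl, rfl⟩ : ∃ c, a = c - l ∧ b = c + l := ⟨a + l, by ring, by linarith⟩
  rw [PlanarCapacity.logCapacity_realSegment c hl]
  refine ⟨rfl, PlanarCapacity.isTransfiniteDiameter_realSegment c hl,
    PlanarCapacity.isChebyshevConstant_realSegment c hl, ?_, ?_, ?_⟩
  · rw [ENNReal.ofReal_lt_one]
    constructor <;> intro h <;> linarith
  · rw [ENNReal.ofReal_eq_one]
    constructor <;> intro h <;> linarith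
  · rw [ENNReal.one_lt_ofReal]
    constructor <;> intro h <;> linarith
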